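/- **Setting.** An instance consists of disjoint sets $M$ (men) and $W$ (women) with $|M|=|W|=n$, and, for every agent $i$, a strict total order $\succ_i$ (the true preference list) on the other side. A matching is a bijection $\mu$ between $M$ and $W$. A pair $(m,w)$ blocks $\mu$ if $w\succ_m\mu(m)$ and $m\succ_w\mu(w)$ (true preferences). $\mu$ is stable if no pair blocks it, and, for $X\subseteq M\times W$, $X$-stable if every blocking pair belongs to $X$. Let $P\subseteq M\times W$ be a set of strategic pairs. A strategy profile $\mathbf p=(\mathbf p_m)_{m\in M}$ consists of the lists reported by the men; men who belong to no pair of $P$ report truthfully, and so do all women. Let $\mathrm{DA}(\mathbf p)=\mu_{\mathbf p}$ be the outcome of the men-proposing deferred acceptance algorithm on $\mathbf p$ and the women's true lists. An accomplice manipulation at $\mathbf p$ by $(m,w)\in P$ is a list $\mathbf p'_m$ such that, for $\mathbf p'=(\mathbf p_{-m},\mathbf p'_m)$, one has $\mu_{\mathbf p'}(w)\succ_w\mu_{\mathbf p}(w)$ and $\mu_{\mathbf p'}(m)\succeq_m\mu_{\mathbf p}(m)$ (true preferences). $\mathbf p$ is a Nash equilibrium (NE) for $P$ if no pair in $P$ can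 perform an accomplice manipulation at $\mathbf p$. The list $\mathbf p'_m$ is a push-up of $\mathbf p_m$ at $\mathbf p$ if, for some set $X\subseteq W$, the women above $\mu_{\mathbf p}(m)$ in $\mathbf p'_m$ are those above $\mu_{\mathbf p}(m)$ in $\mathbf p_m$ together with $X$ (in any order), and the women below $\mu_{\mathbf p}(m)$ in $\mathbf p'_m$ are the remaining women below $\mu_{\mathbf p}(m)$ in $\mathbf p_m$, in unchanged relative order. A push-up dynamic for $P$ is a sequence $\mathbf p^{(1)},\mathbf p^{(2)},\dots$ of profiles such that $\mathbf p^{(1)}$ is truthful and, for every $t$, $\mathbf p^{(t+1)}$ results from an accomplice manipulation by some pair in $P$ at $\mathbf p^{(t)}$ that is a push-up, if there is one, and $\mathbf p^{(t+1)}=\mathbf p^{(t)}$ otherwise. It converges with fixed point $\mathbf p^{(t)}$ if $\mathbf p^{(t+1)}=\mathbf p^{(t)}$. **Theorem (Stability of Nash Equilibria).** For every instance and every $P\subseteq M\times W$: (i) There are push-up dynamics for $P$; every one of them converges; and every fixed point $\mathbf p^*$ of a push-up dynamic is an NE strategy profile for $P$ whose matching $\mathrm{DA}(\mathbf p^*)$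 is stable with respect to the true preferences. (ii) Some NE profiles result in a matching that is unstable with respect to the true preferences: for $M=\{m_1,\dots,m_5\}$, $W=\{w_1,\dots,w_5\}$ with true lists (in decreasing order of preference, $j$ standing for $w_j$ in men's lists and for $m_j$ in women's lists) $$m_1:2,1,3,4,5\quad m_2:1,2,3,4,5\quad m_3:1,3,4,2,5\quad m_4:4,5,1,2,3\quad m_5:5,4,1,2,3,$$ $$w_1:1,3,2,4,5\quad w_2:2,1,3,4,5\quad w_3:3,1,2,4,5\quad w_4:5,3,1,2,4\quad w_5:4,1,2,3,5,$$ and $P=\{(m_3,w_4)\}$, the strategy profile in which $m_3$ reports $w_4,w_3,w_1,w_2,w_5$ and all other men are truthful is an NE, but its matching is unstable: $(m_3,w_1)$ blocks it. However, for every instance and every $P$, the matching of every NE profile is $\big((M\times W)\setminus P\big)$-stable. Thus, if $P=M\times W$, the matching of every NE profile is stable. (These last two claims hold even if the NE profile involves misreports by men who belong to no pair of $P$.) -/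

import Mathlib

/-- A preference list over a set `A` of `n` agents: a strict total order, recorded by the position
of each agent in the list (position `0` is the favourite). -/
abbrev PrefList (A : Type*) (n : ℕ) := A ≃ Fin n

/-- The preference list in which the agents occur in the order `f 0, f 1, …`. -/
def listPref {n : ℕ} (f : Fin n → Fin n) (hf : Function.Bijective f) : PrefList (Fin n) n where
  toFun := Fintype.bijInv hf
  invFun := f
  left_inv := Fintype.rightInverse_bijInv hf
  right_inv := Fintype.leftInverse_bijInv hf

/-- A stable matching instance: `n` men `M`, `n` women `W`, and the true preference lists. -/
structure Market (M W : Type*) [Fintype M] [Fintype W] (n : ℕ) where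
  card_men : Fintype.card M = n
  card_women : Fintype.card W = n
  men : M → PrefList W n
  women : W → PrefList M n

/-! ### Deferred acceptance -/

/-- The woman to whom `m` (newly or still) proposes when exactly the first `k m` women on his list
have rejected him: the first remaining woman on his list, if there is one. -/
def target {M W : Type*} {n : ℕ} (p : M → PrefList W n) (k : M → ℕ) (m : M) : Option W :=
  if h : k m < n then some ((p m).symm ⟨k m, h⟩) else none

/-- In the state `k`, woman `w` rejects `m`: he is among her current proposers (the man she
holds and the men newly proposing to her), and she prefers another one of them. -/
def Rejects {M W : Type*} {n : ℕ} (p : M → PrefList W n) (q : W → PrefList M n)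
    (k : M → ℕ) (w : W) (m : M) : Prop :=
  target p k m = some w ∧ ∃ m', target p k m' = some w ∧ q w m' < q w m

instance {M W : Type*} [Fintype M] [DecidableEq W] {n : ℕ} (p : M → PrefList W n)
    (q : W → PrefList M n) (k : M → ℕ) (w : W) (m : M) : Decidable (Rejects p q k w m) := by
  unfold Rejects; infer_instance

/-- One round of deferred acceptance: the proposal phase followed by the rejection phase. -/
def daRound {M W : Type*} [Fintype M] [Fintype W] [DecidableEq W] {n : ℕ}
    (p : M → PrefList W n) (q : W → PrefList M n) (k : M → ℕ) : M → ℕ :=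
  fun m => if ∃ w, Rejects p q k w m then k m + 1 else k m

/-- The state after `t` rounds: for each man the number of women who have rejected him. -/
def daState {M W : Type*} [Fintype M] [Fintype W] [DecidableEq W] {n : ℕ}
    (p : M → PrefList W n) (q : W → PrefList M n) (t : ℕ) : M → ℕ :=
  (daRound p q)^[t] (fun _ => 0)

theorem target_eq_some {M W : Type*} {n : ℕ} (p : M → PrefList W n) (k : M → ℕ) (m : M) (w : W) :
    target p k m = some w ↔ (p m w : ℕ) = k m := by
  unfold target
  split_ifs with h
  · rw [Option.some_inj, Equiv.symm_apply_eq, Fin.ext_iff]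
    exact eq_comm
  · have := (p m w).isLt
    simp only [false_iff]
    omega

theorem daState_succ {M W : Type*} [Fintype M] [Fintype W] [DecidableEq W] {n : ℕ}
    (p : M → PrefList W n) (q : W → PrefList M n) (t : ℕ) :
    daState p q (t + 1) = daRound p q (daState p q t) :=
  Function.iterate_succ_apply' _ _ _

theorem daState_le {M W : Type*} [Fintype M] [Fintype W] [DecidableEq W] {n : ℕ}
    (p : M → PrefList W n) (q : W → PrefList M n) (t : ℕ) (m : M) : daState p q t m ≤ n := by
  induction t with
  | zero => exact Nat.zero_le _
  | succ t ih =>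
    rw [daState_succ]
    unfold daRound
    split_ifs with h
    · obtain ⟨w, hw, -⟩ := h
      have := (target_eq_some _ _ _ _).1 hw
      have := (p m w).isLt
      omega
    · exact ih

/-- A woman who has rejected a man is being proposed to by a man whom she prefers. -/
theorem daState_rejected {M W : Type*} [Fintype M] [Fintype W] [DecidableEq W] {n : ℕ}
    (p : M → PrefList W n) (q : W → PrefList M n) (t : ℕ) (m : M) (w : W)
    (h : (p m w : ℕ) < daState p q t m) :
    ∃ m', target p (daState p q t) m' = some w ∧ q w m' < q w m := by
  induction t with
  | zero => exact absurd h (Nat.not_lt_zero _)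
  | succ t ih =>
    have key : ∃ m', target p (daState p q t) m' = some w ∧ q w m' < q w m := by
      by_cases h' : (p m w : ℕ) < daState p q t m
      · exact ih h'
      · rw [daState_succ] at h
        unfold daRound at h
        have hr : ∃ w', Rejects p q (daState p q t) w' m := by
          by_contra hr
          rw [if_neg hr] at h
          exact h' h
        rw [if_pos hr] at h
        obtain ⟨w', hw', hm'⟩ := hr
        have e := (target_eq_some _ _ _ _).1 hw'
        have : p m w = p m w' := Fin.ext (by omega)
        rw [(p m).injective this]
        exact hm'
    classical
    obtain ⟨m₁, hm₁, hlt⟩ := key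
    obtain ⟨m₂, hm₂, hmin⟩ := Finset.exists_min_image
      (Finset.univ.filter fun m' => target p (daState p q t) m' = some w) (fun m' => q w m')
      ⟨m₁, by simpa using hm₁⟩
    have ht : target p (daState p q t) m₂ = some w := by simpa using hm₂
    refine ⟨m₂, ?_, lt_of_le_of_lt (hmin m₁ (by simpa using hm₁)) hlt⟩
    have hno : ¬ ∃ w', Rejects p q (daState p q t) w' m₂ := by
      rintro ⟨w', hw', m₃, hm₃, hl⟩
      obtain rfl : w' = w := Option.some_inj.1 (hw'.symm.trans ht)
      exact absurd (hmin m₃ (by simpa using hm₃)) (not_le.2 hl)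
    rw [target_eq_some] at ht ⊢
    rw [ht, daState_succ]
    unfold daRound
    rw [if_neg hno]

/-- After `n * n` rounds the algorithm has terminated. -/
theorem daState_fixed {M W : Type*} [Fintype M] [Fintype W] [DecidableEq W] {n : ℕ}
    (hM : Fintype.card M = n) (p : M → PrefList W n) (q : W → PrefList M n) :
    daState p q (n * n + 1) = daState p q (n * n) := by
  by_contra hne
  have hmono : ∀ t m, daState p q t m ≤ daState p q (t + 1) m := by
    intro t m
    rw [daState_succ]
    unfold daRound
    split_ifs <;> omega
  have hlow : ∀ t, daState p q (t + 1) ≠ daState p q t → t + 1 ≤ ∑ m, daState p q (t + 1) m := by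
    intro t
    induction t with
    | zero =>
      intro h
      obtain ⟨m, hm⟩ := Function.ne_iff.1 h
      have h1 := Finset.sum_lt_sum (fun m _ => hmono 0 m)
        ⟨m, Finset.mem_univ m, lt_of_le_of_ne (hmono 0 m) (Ne.symm hm)⟩
      omega
    | succ t ih =>
      intro h
      have h0 : daState p q (t + 1) ≠ daState p q t := by
        intro e
        apply h
        rw [daState_succ p q (t + 1), e, ← daState_succ]
        exact e.symm ▸ rfl
      obtain ⟨m, hm⟩ := Function.ne_iff.1 h
      have h1 := Finset.sum_lt_sum (fun m _ => hmono (t + 1) m)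
        ⟨m, Finset.mem_univ m, lt_of_le_of_ne (hmono (t + 1) m) (Ne.symm hm)⟩
      have h2 := ih h0
      omega
  have h1 := hlow _ hne
  have h2 : ∑ m, daState p q (n * n + 1) m ≤ ∑ _m : M, n :=
    Finset.sum_le_sum fun m _ => daState_le p q _ m
  rw [Finset.sum_const, Finset.card_univ, hM, smul_eq_mul] at h2
  omega

/-- On termination two men never propose to the same woman. -/
theorem daState_inj {M W : Type*} [Fintype M] [Fintype W] [DecidableEq W] {n : ℕ}
    (hM : Fintype.card M = n) (p : M → PrefList W n) (q : W → PrefList M n) (m m' : M) (w : W)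
    (h : target p (daState p q (n * n)) m = some w)
    (h' : target p (daState p q (n * n)) m' = some w) : m = m' := by
  have aux : ∀ m m' : M, target p (daState p q (n * n)) m = some w →
      target p (daState p q (n * n)) m' = some w → ¬ q w m' < q w m := by
    intro m m' h h' hlt
    have e := congrFun (daState_fixed hM p q) m
    rw [daState_succ] at e
    unfold daRound at e
    rw [if_pos ⟨w, h, m', h', hlt⟩] at e
    omega
  exact (q w).injective (le_antisymm (not_lt.1 (aux m m' h h')) (not_lt.1 (aux m' m h' h)))

/-- On termination every man is held by some woman. -/
theorem daState_lt {M W : Type*} [Fintype M] [Fintype W] [DecidableEq W] {n : ℕ}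
    (hM : Fintype.card M = n) (hW : Fintype.card W = n)
    (p : M → PrefList W n) (q : W → PrefList M n) (m : M) : daState p q (n * n) m < n := by
  by_contra hlt
  have hall : ∀ w, ∃ m', target p (daState p q (n * n)) m' = some w := by
    intro w
    obtain ⟨m', h, -⟩ := daState_rejected p q (n * n) m w
      (lt_of_lt_of_le (p m w).isLt (not_lt.1 hlt))
    exact ⟨m', h⟩
  choose f hf using hall
  have hinj : Function.Injective f := fun w w' e =>
    Option.some_inj.1 ((hf w).symm.trans (e ▸ hf w'))
  obtain ⟨w, rfl⟩ := ((Fintype.bijective_iff_injective_and_card f).2 ⟨hinj, hW.trans hM.symm⟩).2 m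
  have e := (target_eq_some _ _ _ _).1 (hf w)
  have := (p (f w) w).isLt
  omega

/-- The outcome of the deferred acceptance algorithm (men proposing), on the reported lists `p` of
the men and `q` of the women: each man is matched to the woman who holds his proposal when the
algorithm has terminated. -/
noncomputable def deferredAcceptance {M W : Type*} [Fintype M] [Fintype W] [DecidableEq W] {n : ℕ}
    (hM : Fintype.card M = n) (hW : Fintype.card W = n)
    (p : M → PrefList W n) (q : W → PrefList M n) : M ≃ W :=
  Equiv.ofBijective
    (fun m => (p m).symm ⟨daState p q (n * n) m, daState_lt hM hW p q m⟩) <| by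
      refine (Fintype.bijective_iff_injective_and_card _).2 ⟨fun m m' e => ?_, hM.trans hW.symm⟩
      refine daState_inj hM p q m m'
        ((p m).symm ⟨daState p q (n * n) m, daState_lt hM hW p q m⟩) ?_ ?_
      · rw [target_eq_some, Equiv.apply_symm_apply]
      · dsimp only at e
        rw [target_eq_some, e, Equiv.apply_symm_apply]

namespace Market

variable {M W : Type*} [Fintype M] [Fintype W] [DecidableEq M] [DecidableEq W] {n : ℕ}

/-! ### Stability with respect to the true preferences -/

/-- `(m, w)` is a blocking pair of the matching `μ` for the true preferences. -/
def IsBlocking (I : Market M W n) (μ : M ≃ W) (m : M) (w : W) : Prop :=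
  I.men m w < I.men m (μ m) ∧ I.women w m < I.women w (μ.symm w)

def IsStable (I : Market M W n) (μ : M ≃ W) : Prop :=
  ∀ m w, ¬ I.IsBlocking μ m w

/-- `X`-stability: every blocking pair (if there is one) belongs to `X`. -/
def IsXStable (I : Market M W n) (X : Set (M × W)) (μ : M ≃ W) : Prop :=
  ∀ m w, I.IsBlocking μ m w → (m, w) ∈ X

/-! ### The accomplice manipulation game with strategic pairs `P` -/

/-- The outcome of deferred acceptance when the men report `p` and the women are truthful. -/
noncomputable def DA (I : Market M W n) (p : M → PrefList W n) : M ≃ W :=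
  deferredAcceptance I.card_men I.card_women p I.women

/-- Only strategic men, i.e. men who belong to some pair in `P`, may misreport. -/
def IsStrategyProfile (I : Market M W n) (P : Set (M × W)) (p : M → PrefList W n) : Prop :=
  ∀ m, (∀ w, (m, w) ∉ P) → p m = I.men m

/-- Reporting `L` instead of `p m` is an accomplice manipulation by the strategic pair `(m, w)` at
`p`: `w` becomes strictly better off and `m` does not become worse off (incurs no regret), both
according to the true preferences. -/
def IsAccompliceManipulation (I : Market M W n) (P : Set (M × W)) (p : M → PrefList W n)
    (m : M) (w : W) (L : PrefList W n) : Prop :=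
  (m, w) ∈ P ∧
  I.women w ((I.DA (Function.update p m L)).symm w) < I.women w ((I.DA p).symm w) ∧
  I.men m (I.DA (Function.update p m L) m) ≤ I.men m (I.DA p m)

/-- No strategic pair can perform an accomplice manipulation at `p`. -/
def IsNash (I : Market M W n) (P : Set (M × W)) (p : M → PrefList W n) : Prop :=
  ¬ ∃ m w L, I.IsAccompliceManipulation P p m w L

/-! ### Push-up dynamics -/

/-- The list `L'` results from `L` by pushing the women in `X` up above `w₀` (the current partner):
the women above `w₀` are now those who were above her before together with `X`, in any order, and
the women below `w₀` are the other ones who were below her, in their original order. -/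
def IsPushUp (L L' : PrefList W n) (w₀ : W) (X : Set W) : Prop :=
  {w | L' w < L' w₀} = {w | L w < L w₀} ∪ X ∧
  {w | L' w₀ < L' w} = {w | L w₀ < L w} \ X ∧
  ∀ w w', L' w₀ < L' w → L' w₀ < L' w' → (L' w < L' w' ↔ L w < L w')

/-- The profile `p'` results from a (no-regret) push-up accomplice manipulation at `p` by some
strategic pair. -/
def PushUpStep (I : Market M W n) (P : Set (M × W)) (p p' : M → PrefList W n) : Prop :=
  ∃ m w L X, I.IsAccompliceManipulation P p m w L ∧ IsPushUp (p m) L (I.DA p m) X ∧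
    p' = Function.update p m L

/-- A push-up dynamic: it starts at the truthful profile, and each next profile results from a
push-up accomplice manipulation if there is one, and is the same profile otherwise. -/
def IsPushUpDynamic (I : Market M W n) (P : Set (M × W)) (p : ℕ → M → PrefList W n) : Prop :=
  p 0 = I.men ∧
  ∀ t, I.PushUpStep P (p t) (p (t + 1)) ∨
    ((¬ ∃ p', I.PushUpStep P (p t) p') ∧ p (t + 1) = p t)

end Market

/-! ### A market with five men and five women

Man `m_i` is `i - 1 : Fin 5` and woman `w_j` is `j - 1 : Fin 5`; the lists are in order of
decreasing preference. -/

def fiveMarket : Market (Fin 5) (Fin 5) 5 where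
  card_men := rfl
  card_women := rfl
  men := ![listPref ![1, 0, 2, 3, 4] (by decide), listPref ![0, 1, 2, 3, 4] (by decide),
    listPref ![0, 2, 3, 1, 4] (by decide), listPref ![3, 4, 0, 1, 2] (by decide),
    listPref ![4, 3, 0, 1, 2] (by decide)]
  women := ![listPref ![0, 2, 1, 3, 4] (by decide), listPref ![1, 0, 2, 3, 4] (by decide),
    listPref ![2, 0, 1, 3, 4] (by decide), listPref ![4, 2, 0, 1, 3] (by decide),
    listPref ![3, 0, 1, 2, 4] (by decide)]

/-- All men report truthfully, except that `m_3` reports `w_4, w_3, w_1, w_2, w_5`. -/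
def fiveProfile : Fin 5 → PrefList (Fin 5) 5 :=
  Function.update fiveMarket.men 2 (listPref ![3, 2, 0, 1, 4] (by decide))

/-! ### Deferred acceptance: stability and the blocking lemma -/

/-! Everything rests on the blocking lemma `exists_blocking_of_preferred`. It gives
strategy-proofness for the proposing men (`DA_strategyProof`), and it shows that a change of list
which keeps the man's partner and every woman above her can only hurt men and help women
(`DA_le_of_above_subset`).

Along a push-up dynamic the invariant `TruthfulBelow` persists. By strategy-proofness, a no-regret
change then leaves the manipulating man's partner unchanged, so each step improves the women weakly
and one of them strictly; hence the dynamic converges. The invariant also makes every outcome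
stable. At a fixed point no push-up manipulation is left, and hence no manipulation at all: pushing
up the women whom an arbitrary manipulation ranks above the partner serves the accomplice at least
as well.

At an arbitrary equilibrium, a blocking pair in `P` could manipulate by pushing up its own woman.
This uses stability for the reported lists and strategy-proofness, but no invariant. -/

theorem daState_mono {M W : Type*} [Fintype M] [Fintype W] [DecidableEq W] {n : ℕ}
    (p : M → PrefList W n) (q : W → PrefList M n) (m : M) :
    Monotone fun t => daState p q t m := by
  refine monotone_nat_of_le_succ fun t => ?_
  rw [daState_succ]
  unfold daRound
  split_ifs <;> omega

/-- A woman who has rejected a man by the end of a round has, in the course of that round, held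
on to a man whom she prefers. -/
theorem exists_held_of_daState_succ {M W : Type*} [Fintype M] [Fintype W] [DecidableEq W] {n : ℕ}
    (p : M → PrefList W n) (q : W → PrefList M n) (t : ℕ) (m : M) (w : W)
    (h : (p m w : ℕ) < daState p q (t + 1) m) :
    ∃ m', target p (daState p q t) m' = some w ∧ target p (daState p q (t + 1)) m' = some w ∧
      q w m' < q w m := by
  obtain ⟨m', h1, h2⟩ := daState_rejected p q (t + 1) m w h
  by_cases h0 : target p (daState p q t) m' = some w
  · exact ⟨m', h0, h1, h2⟩
  have key : ∃ m', target p (daState p q t) m' = some w ∧ q w m' < q w m := by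
    by_cases h' : (p m w : ℕ) < daState p q t m
    · exact daState_rejected p q t m w h'
    · rw [daState_succ] at h
      unfold daRound at h
      split_ifs at h with hr
      · obtain ⟨w', hw', hm'⟩ := hr
        have e := (target_eq_some _ _ _ _).1 hw'
        have : p m w = p m w' := Fin.ext (by omega)
        rw [(p m).injective this]
        exact hm'
      · exact absurd h h'
  classical
  -- The best of the men proposing to `w` in state `t` is not rejected, so he is still there in
  -- state `t + 1`.
  obtain ⟨m₁, hm₁, hlt⟩ := key
  obtain ⟨m₂, hm₂, hmin⟩ := Finset.exists_min_image
    (Finset.univ.filter fun m' => target p (daState p q t) m' = some w) (fun m' => q w m')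
    ⟨m₁, by simpa using hm₁⟩
  have ht : target p (daState p q t) m₂ = some w := by simpa using hm₂
  refine ⟨m₂, ht, ?_, lt_of_le_of_lt (hmin m₁ (by simpa using hm₁)) hlt⟩
  have hno : ¬ ∃ w', Rejects p q (daState p q t) w' m₂ := by
    rintro ⟨w', hw', m₃, hm₃, hl⟩
    obtain rfl : w' = w := Option.some_inj.1 (hw'.symm.trans ht)
    exact absurd (hmin m₃ (by simpa using hm₃)) (not_le.2 hl)
  rw [target_eq_some] at ht ⊢
  rw [ht, daState_succ]
  unfold daRound
  rw [if_neg hno]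

theorem rank_deferredAcceptance {M W : Type*} [Fintype M] [Fintype W] [DecidableEq W] {n : ℕ}
    (hM : Fintype.card M = n) (hW : Fintype.card W = n)
    (p : M → PrefList W n) (q : W → PrefList M n) (m : M) :
    (p m (deferredAcceptance hM hW p q m) : ℕ) = daState p q (n * n) m := by
  simp [deferredAcceptance]

theorem deferredAcceptance_eq_of_target {M W : Type*} [Fintype M] [Fintype W] [DecidableEq W]
    {n : ℕ} (hM : Fintype.card M = n) (hW : Fintype.card W = n)
    (p : M → PrefList W n) (q : W → PrefList M n) (m : M) (w : W)
    (h : target p (daState p q (n * n)) m = some w) : deferredAcceptance hM hW p q m = w := by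
  apply (p m).injective
  rw [Fin.ext_iff, rank_deferredAcceptance, ← (target_eq_some _ _ _ _).1 h]

/-- The outcome of deferred acceptance is stable for the reported lists. -/
theorem deferredAcceptance_stable {M W : Type*} [Fintype M] [Fintype W] [DecidableEq W] {n : ℕ}
    (hM : Fintype.card M = n) (hW : Fintype.card W = n)
    (p : M → PrefList W n) (q : W → PrefList M n) (m : M) (w : W)
    (h : p m w < p m (deferredAcceptance hM hW p q m)) :
    q w ((deferredAcceptance hM hW p q).symm w) < q w m := by
  rw [Fin.lt_def, rank_deferredAcceptance] at h
  obtain ⟨m', h1, h2⟩ := daState_rejected p q _ m w h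
  rw [← deferredAcceptance_eq_of_target hM hW p q m' w h1] at h2 ⊢
  rwa [Equiv.symm_apply_apply]

/-- The blocking lemma: if some man prefers `ν` to the outcome of deferred acceptance, then `ν` is
blocked by a pair whose man does not. -/
theorem exists_blocking_of_preferred {M W : Type*} [Fintype M] [Fintype W] [DecidableEq W] {n : ℕ}
    (hM : Fintype.card M = n) (hW : Fintype.card W = n)
    (p : M → PrefList W n) (q : W → PrefList M n) (ν : M ≃ W) (m₀ : M)
    (h₀ : p m₀ (ν m₀) < p m₀ (deferredAcceptance hM hW p q m₀)) :
    ∃ m w, p m (deferredAcceptance hM hW p q m) ≤ p m (ν m) ∧ p m w < p m (ν m) ∧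
      q w m < q w (ν.symm w) := by
  classical
  set μ := deferredAcceptance hM hW p q with hμ
  have hrank : ∀ m, (p m (μ m) : ℕ) = daState p q (n * n) m := rank_deferredAcceptance hM hW p q
  set S : Finset M := Finset.univ.filter fun m => p m (ν m) < p m (μ m) with hS
  have memS : ∀ m, m ∈ S ↔ p m (ν m) < p m (μ m) := fun m => by simp [hS]
  by_cases hcase : ∀ s ∈ S, μ.symm (ν s) ∈ S
  -- Here `μ` and `ν` match `S`, the men who prefer `ν`, to the same set of women.
  · have himg : S.image (fun s => μ.symm (ν s)) = S := by
      apply Finset.eq_of_subset_of_card_le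
      · intro x hx
        obtain ⟨s, hs, rfl⟩ := Finset.mem_image.1 hx
        exact hcase s hs
      · exact (Finset.card_image_of_injective S (μ.symm.injective.comp ν.injective)).ge
    -- `T` is the first time at which all men of `S` have reached their final proposals; it is
    -- positive because `m₀` is rejected by `ν m₀`.
    have hex : ∃ t, ∀ s ∈ S, daState p q t s = daState p q (n * n) s := ⟨n * n, fun _ _ => rfl⟩
    have hle : Nat.find hex ≤ n * n := Nat.find_min' hex fun _ _ => rfl
    have hspec := Nat.find_spec hex
    have hmin := fun t => Nat.find_min hex (m := t)
    generalize Nat.find hex = T at hle hspec hmin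
    cases T with
    | zero =>
      have h1 := hspec m₀ ((memS _).2 h₀)
      rw [← hrank] at h1
      have h2 := Fin.lt_def.1 h₀
      exact absurd (h1.symm.trans rfl : _ = 0) (Nat.ne_of_gt ((Nat.zero_le _).trans_lt h2))
    | succ t =>
      have ht := hmin t (Nat.lt_succ_self t)
      push Not at ht
      obtain ⟨s, hs, hst⟩ := ht
      obtain ⟨s', hs', hss'⟩ : ∃ s' ∈ S, μ.symm (ν s') = s := by
        -- The man `s` is among the last of `S` to arrive at his partner. She has by then rejected
        -- `s'`, her partner under `ν`, so she held some `m'` both before and after the arrival. He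
        -- is neither `s` nor another man of `S`, as those are with their own partners; he blocks
        -- `ν` with her.
        rw [← himg] at hs
        simpa using hs
      have hw : ν s' = μ s := by rw [← hss', Equiv.apply_symm_apply]
      have hrej : (p s' (μ s) : ℕ) < daState p q (t + 1) s' := by
        rw [hspec s' hs', ← hrank, ← hw]
        exact (memS _).1 hs'
      obtain ⟨m', h1, h2, h3⟩ := exists_held_of_daState_succ p q t s' (μ s) hrej
      rw [target_eq_some] at h1 h2
      have hm's : m' ≠ s := by
        rintro rfl
        exact hst (by rw [← h1, hrank])
      have hm'S : m' ∉ S := by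
        intro hm'
        rw [hspec m' hm', ← hrank] at h2
        exact hm's (μ.injective ((p m').injective (Fin.ext h2))).symm
      have hle' : p m' (μ m') ≤ p m' (ν m') := not_lt.1 fun h => hm'S ((memS _).2 h)
      refine ⟨m', μ s, hle', lt_of_lt_of_le (lt_of_le_of_ne ?_ ?_) hle', ?_⟩
      · rw [Fin.le_def, h2, hrank]
        exact daState_mono p q m' hle
      · exact fun e => hm's (μ.injective ((p m').injective e)).symm
      · rwa [← hw, Equiv.symm_apply_apply, hw]
  · push Not at hcase
    -- The woman `ν s` has a partner outside `S` under `μ`; having rejected `s` for someone better,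
    -- she prefers that partner to `s`.
    obtain ⟨s, hs, hs'⟩ := hcase
    have hle : p (μ.symm (ν s)) (μ (μ.symm (ν s))) ≤ p (μ.symm (ν s)) (ν (μ.symm (ν s))) :=
      not_lt.1 fun h => hs' ((memS _).2 h)
    refine ⟨μ.symm (ν s), ν s, hle, ?_, ?_⟩
    · rw [Equiv.apply_symm_apply] at hle
      refine lt_of_le_of_ne hle fun e => ?_
      have := ν.injective ((p _).injective e)
      rw [← this] at hs'
      exact hs' hs
    · rw [Equiv.symm_apply_apply]
      exact deferredAcceptance_stable hM hW p q s (ν s) ((memS _).1 hs)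

/-- A preference list ordered by an injective key. -/
theorem exists_prefList_of_injective {A : Type*} [Fintype A] {n : ℕ} (hA : Fintype.card A = n)
    (f : A → ℕ) (hf : Function.Injective f) :
    ∃ L : PrefList A n, ∀ a b, L a < L b ↔ f a < f b := by
  let _ : LinearOrder A := LinearOrder.lift' f hf
  exact ⟨(Fintype.orderIsoFinOfCardEq A hA).symm.toEquiv,
    fun a b => (Fintype.orderIsoFinOfCardEq A hA).symm.lt_iff_lt⟩

/-! ### Push-ups and the effect of changing one man's list -/

namespace Market

variable {M W : Type*} [Fintype M] [Fintype W] [DecidableEq M] [DecidableEq W] {n : ℕ}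

theorem exists_isPushUp (hW : Fintype.card W = n) (L : PrefList W n) (w₀ : W) (X : Set W)
    (hX : w₀ ∉ X) : ∃ L', IsPushUp L L' w₀ X := by
  classical
  set Y : Set W := {w | L w < L w₀} ∪ X with hY
  have h₀ : w₀ ∉ Y := by simp [hY, hX]
  have hval : ∀ {a b : W}, (L a : ℕ) = L b → a = b := fun h => L.injective (Fin.ext h)
  -- The shift by `n` puts everyone outside `Y` below all of `Y`; since `Y` contains all women above
  -- `w₀`, she comes first among the rest.
  obtain ⟨L', hL'⟩ := exists_prefList_of_injective hW
    (fun w => if w ∈ Y then (L w : ℕ) else n + L w) (by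
      intro a b h
      have := (L a).isLt
      have := (L b).isLt
      dsimp only at h
      split_ifs at h
      · exact hval h
      · omega
      · omega
      · exact hval (by omega))
  have hup : ∀ w, L' w < L' w₀ ↔ w ∈ Y := by
    intro w
    rw [hL', if_neg h₀]
    by_cases hw : w ∈ Y
    · have := (L w).isLt
      simp only [hw, if_true, iff_true]
      omega
    · have : ¬ (L w : ℕ) < L w₀ := fun h => hw (Or.inl h)
      simp only [hw, if_false, iff_false]
      omega
  have hdown : ∀ w, L' w₀ < L' w ↔ L w₀ < L w ∧ w ∉ X := by
    intro w
    constructor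
    · intro h
      have hw : w ∉ Y := fun hw => lt_asymm h ((hup w).2 hw)
      rw [hL', if_neg h₀, if_neg hw] at h
      exact ⟨Fin.lt_def.2 (by omega), fun hx => hw (Or.inr hx)⟩
    · rintro ⟨h, hx⟩
      have hw : w ∉ Y := by
        rintro (h' | h')
        · exact lt_asymm h h'
        · exact hx h'
      rw [hL', if_neg h₀, if_neg hw]
      have := Fin.lt_def.1 h
      omega
  refine ⟨L', Set.ext hup, Set.ext hdown, fun w w' hw hw' => ?_⟩
  have h1 : w ∉ Y := fun h => lt_asymm hw ((hup w).2 h)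
  have h2 : w' ∉ Y := fun h => lt_asymm hw' ((hup w').2 h)
  rw [hL', if_neg h1, if_neg h2, Fin.lt_def]
  omega

variable (I : Market M W n)

theorem DA_stable (p : M → PrefList W n) (m : M) (w : W) (h : p m w < p m (I.DA p m)) :
    I.women w ((I.DA p).symm w) < I.women w m :=
  deferredAcceptance_stable _ _ p I.women m w h

/-- Deferred acceptance is strategy-proof for the men. -/
theorem DA_strategyProof (p : M → PrefList W n) (m : M) (L L' : PrefList W n) :
    L (I.DA (Function.update p m L) m) ≤ L (I.DA (Function.update p m L') m) := by
  by_contra h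
  obtain ⟨m', w, h1, h2, h3⟩ := exists_blocking_of_preferred I.card_men I.card_women
    (Function.update p m L) I.women (I.DA (Function.update p m L')) m (by
      rw [Function.update_self]
      exact not_le.1 h)
  -- The blocking man does not prefer the outcome under `L'`, so he is not `m`; his list is the same
  -- in both profiles, against stability under `L'`.
  have hne : m' ≠ m := by
    rintro rfl
    rw [Function.update_self] at h1
    exact h h1
  refine lt_asymm h3 (I.DA_stable (Function.update p m L') m' w ?_)
  rwa [Function.update_of_ne hne] at h2 ⊢

/-- If a man changes his list so that the women above his partner remain above her, and he keeps
his partner, then all men become weakly worse off and all women weakly better off. -/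
theorem DA_le_of_above_subset (p : M → PrefList W n) (m : M) (L : PrefList W n)
    (hm : I.DA (Function.update p m L) m = I.DA p m)
    (hL : ∀ w, p m w < p m (I.DA p m) → L w < L (I.DA p m)) :
    (∀ m', p m' (I.DA p m') ≤ p m' (I.DA (Function.update p m L) m')) ∧
    ∀ w, I.women w ((I.DA (Function.update p m L)).symm w) ≤ I.women w ((I.DA p).symm w) := by
  -- The new outcome is stable for the old lists too, so the blocking lemma shows that no man
  -- prefers it.
  have hst : ∀ m' w, p m' w < p m' (I.DA (Function.update p m L) m') →
      I.women w ((I.DA (Function.update p m L)).symm w) < I.women w m' := by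
    intro m' w h
    apply I.DA_stable
    rcases eq_or_ne m' m with rfl | hne
    · rw [Function.update_self, hm]
      rw [hm] at h
      exact hL w h
    · rwa [Function.update_of_ne hne]
  have hmen : ∀ m', p m' (I.DA p m') ≤ p m' (I.DA (Function.update p m L) m') := by
    intro m'
    by_contra h
    obtain ⟨m₁, w, -, h2, h3⟩ := exists_blocking_of_preferred I.card_men I.card_women p I.women
      (I.DA (Function.update p m L)) m' (not_le.1 h)
    exact lt_asymm h3 (hst m₁ w h2)
  refine ⟨hmen, fun w => ?_⟩
  have h1 := hmen ((I.DA p).symm w)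
  rw [Equiv.apply_symm_apply] at h1
  rcases h1.eq_or_lt with h | h
  · have h' := (p _).injective h
    have e : (I.DA (Function.update p m L)).symm w = (I.DA p).symm w := by
      rw [Equiv.symm_apply_eq]
      exact h'
    rw [e]
  · exact (hst _ w h).le

/-- A push-up yields the pushing man his old partner or one of the women pushed up. -/
theorem DA_pushUp (p : M → PrefList W n) (m : M) (L : PrefList W n) (X : Set W)
    (hL : IsPushUp (p m) L (I.DA p m) X) :
    I.DA (Function.update p m L) m = I.DA p m ∨ I.DA (Function.update p m L) m ∈ X := by
  have h1 := I.DA_strategyProof p m L (p m)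
  have h2 := I.DA_strategyProof p m (p m) L
  rw [Function.update_eq_self] at h1 h2
  rcases h1.eq_or_lt with h | h
  · exact Or.inl (L.injective h)
  · have : I.DA (Function.update p m L) m ∈ {w | L w < L (I.DA p m)} := h
    rw [hL.1] at this
    rcases this with h' | h'
    · exact absurd h' (not_lt.2 h2)
    · exact Or.inr h'

/-! ### The invariant of push-up dynamics -/

/-- From the current partner downwards, the reported lists agree with the true ones. -/
def TruthfulBelow (p : M → PrefList W n) : Prop :=
  ∀ m w w', p m (I.DA p m) ≤ p m w → p m (I.DA p m) ≤ p m w' →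
    (p m w < p m w' ↔ I.men m w < I.men m w')

variable {I}

/-- A woman reported above the partner cannot block, by stability for the reported lists; one
reported below her is truly worse than the partner. -/
theorem TruthfulBelow.isStable {p : M → PrefList W n} (hp : I.TruthfulBelow p) :
    I.IsStable (I.DA p) := by
  rintro m w ⟨h1, h2⟩
  refine lt_asymm h2 (I.DA_stable p m w ?_)
  by_contra h
  exact absurd ((hp m w _ (not_lt.1 h) le_rfl).2 h1) h

/-- By strategy-proofness the new partner is not above the old one in `p m`; there the list is
truthful, so a different partner would mean regret. -/
theorem TruthfulBelow.partner_eq {p : M → PrefList W n} (hp : I.TruthfulBelow p) (m : M)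
    (L : PrefList W n) (h : I.men m (I.DA (Function.update p m L) m) ≤ I.men m (I.DA p m)) :
    I.DA (Function.update p m L) m = I.DA p m := by
  have h2 := I.DA_strategyProof p m (p m) L
  rw [Function.update_eq_self] at h2
  rcases h2.eq_or_lt with h' | h'
  · exact ((p m).injective h').symm
  · exact absurd ((hp m _ _ le_rfl h2).1 h') (not_lt.2 h)

/-- The pusher keeps his partner and the order below her, and the other men move weakly down their
lists, so the truthful parts only shrink. -/
theorem PushUpStep.women_le {P : Set (M × W)} {p p' : M → PrefList W n}
    (h : I.PushUpStep P p p') (hp : I.TruthfulBelow p) :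
    I.TruthfulBelow p' ∧
    (∀ w, I.women w ((I.DA p').symm w) ≤ I.women w ((I.DA p).symm w)) ∧
    ∃ w, I.women w ((I.DA p').symm w) < I.women w ((I.DA p).symm w) := by
  obtain ⟨m, w, L, X, ⟨-, hw, hm⟩, hL, rfl⟩ := h
  have e := hp.partner_eq m L hm
  obtain ⟨hmen, hwomen⟩ := I.DA_le_of_above_subset p m L e fun w' hw' => by
    have : w' ∈ {w | L w < L (I.DA p m)} := hL.1 ▸ Or.inl hw'
    exact this
  refine ⟨fun m' a b ha hb => ?_, hwomen, w, hw⟩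
  rcases eq_or_ne m' m with rfl | hne
  · rw [Function.update_self, e] at ha hb
    rw [Function.update_self]
    have below : ∀ c, L (I.DA p m') < L c → p m' (I.DA p m') < p m' c := fun c hc => by
      have : c ∈ {w | L (I.DA p m') < L w} := hc
      rw [hL.2.1] at this
      exact this.1
    rcases ha.eq_or_lt with ha | ha <;> rcases hb.eq_or_lt with hb | hb
    · rw [← L.injective ha, ← L.injective hb]
      simp
    · rw [← L.injective ha]
      exact iff_of_true hb ((hp m' _ b le_rfl (below b hb).le).1 (below b hb))
    · rw [← L.injective hb]
      exact iff_of_false ha.not_gt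
        (((hp m' _ a le_rfl (below a ha).le).1 (below a ha)).not_gt)
    · rw [hL.2.2 a b ha hb]
      exact hp m' a b (below a ha).le (below b hb).le
  · rw [Function.update_of_ne hne] at ha hb ⊢
    exact hp m' a b ((hmen m').trans ha) ((hmen m').trans hb)

/-- If some accomplice manipulation is possible, then so is one by a push-up. -/
theorem TruthfulBelow.isNash {P : Set (M × W)} {p : M → PrefList W n} (hp : I.TruthfulBelow p)
    (h : ¬ ∃ p', I.PushUpStep P p p') : I.IsNash P p := by
  rintro ⟨m, w, L, hP, hw, hm⟩
  have e := hp.partner_eq m L hm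
  obtain ⟨L', hL'⟩ := exists_isPushUp I.card_women (p m) (I.DA p m) {w | L w < L (I.DA p m)}
    (lt_irrefl (L (I.DA p m)))
  -- A partner from the pushed set would be one whom `L` ranks above the outcome of reporting `L`,
  -- against strategy-proofness with `L` as the true list.
  have e' : I.DA (Function.update p m L') m = I.DA p m := by
    refine (I.DA_pushUp p m L' _ hL').resolve_right fun hx => ?_
    have := I.DA_strategyProof p m L L'
    rw [e] at this
    exact absurd hx (not_lt.2 this)
  -- The comparison starts from the profile with `L`, not from `p`: passing from `L` to `L'` keeps
  -- or increases the gain of `w`.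
  have hwom := (I.DA_le_of_above_subset (Function.update p m L) m L'
    (by rw [Function.update_idem, e, e']) (fun w' hw' => by
      rw [Function.update_self, e] at hw'
      rw [e]
      have : w' ∈ {w | L' w < L' (I.DA p m)} := hL'.1 ▸ Or.inr hw'
      exact this)).2 w
  rw [Function.update_idem] at hwom
  exact h ⟨_, m, w, L', _, ⟨hP, hwom.trans_lt hw, by rw [e']⟩, hL', rfl⟩

theorem truthfulBelow_men (I : Market M W n) : I.TruthfulBelow I.men :=
  fun _ _ _ _ _ => Iff.rfl

/-! ### Existence, convergence and fixed points of push-up dynamics -/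

theorem exists_isPushUpDynamic (I : Market M W n) (P : Set (M × W)) :
    ∃ p, I.IsPushUpDynamic P p := by
  have hex : ∀ p : M → PrefList W n, ∃ p', I.PushUpStep P p p' ∨
      ((¬ ∃ p', I.PushUpStep P p p') ∧ p' = p) := by
    intro p
    by_cases h : ∃ p', I.PushUpStep P p p'
    · exact h.imp fun _ => Or.inl
    · exact ⟨p, Or.inr ⟨h, rfl⟩⟩
  choose f hf using hex
  refine ⟨fun t => f^[t] I.men, rfl, fun t => ?_⟩
  simp only [Function.iterate_succ_apply']
  exact hf _

variable {P : Set (M × W)} {p : ℕ → M → PrefList W n}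

theorem IsPushUpDynamic.truthfulBelow (hp : I.IsPushUpDynamic P p) (t : ℕ) :
    I.TruthfulBelow (p t) := by
  induction t with
  | zero => rw [hp.1]; exact I.truthfulBelow_men
  | succ t ih =>
    rcases hp.2 t with h | ⟨-, h⟩
    · exact (h.women_le ih).1
    · rwa [h]

theorem IsPushUpDynamic.isStrategyProfile (hp : I.IsPushUpDynamic P p) (t : ℕ) :
    I.IsStrategyProfile P (p t) := by
  induction t with
  | zero => rw [hp.1]; exact fun _ _ => rfl
  | succ t ih =>
    rcases hp.2 t with ⟨m, w, L, X, hL, -, h⟩ | ⟨-, h⟩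
    · intro m' hm'
      rw [h, Function.update_of_ne]
      · exact ih m' hm'
      · rintro rfl
        exact hm' w hL.1
    · rwa [h]

/-- The sum of the ranks that the women give to their partners drops at each proper step. -/
theorem IsPushUpDynamic.exists_fixed (hp : I.IsPushUpDynamic P p) : ∃ t, p (t + 1) = p t := by
  by_contra! hne
  refine not_strictAnti_of_wellFoundedLT
    (fun t => ∑ w, (I.women w ((I.DA (p t)).symm w) : ℕ)) (strictAnti_nat_of_succ_lt fun t => ?_)
  obtain h := (hp.2 t).resolve_right fun h => hne t h.2
  obtain ⟨-, hle, w, hlt⟩ := h.women_le (hp.truthfulBelow t)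
  exact Finset.sum_lt_sum (fun w _ => hle w) ⟨w, Finset.mem_univ w, hlt⟩

theorem IsPushUpDynamic.isNash_of_fixed (hp : I.IsPushUpDynamic P p) {t : ℕ}
    (ht : p (t + 1) = p t) : I.IsNash P (p t) := by
  refine (hp.truthfulBelow t).isNash ?_
  rcases hp.2 t with h | ⟨h, -⟩
  · obtain ⟨-, -, w, hlt⟩ := h.women_le (hp.truthfulBelow t)
    rw [ht] at hlt
    exact absurd hlt (lt_irrefl _)
  · exact h

/-! ### Arbitrary equilibria -/

/-- At an equilibrium no strategic pair blocks the outcome. -/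
theorem IsNash.isXStable {p : M → PrefList W n} (hp : I.IsNash P p) :
    I.IsXStable (Set.univ \ P) (I.DA p) := by
  rintro m w ⟨h1, h2⟩
  refine ⟨trivial, fun hP => ?_⟩
  obtain ⟨L, hL⟩ := exists_isPushUp I.card_women (p m) (I.DA p m) {w} (by
    rintro (h : I.DA p m = w)
    rw [h] at h1
    exact lt_irrefl _ h1)
  -- If `m` keeps his partner, `w` now stands above her, so `w` holds someone better than `m`;
  -- otherwise `m` gets `w`. Either way `w` gains without regret for `m`.
  rcases I.DA_pushUp p m L _ hL with h | (h : _ = w)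
  · have hw : L w < L (I.DA p m) := by
      have : w ∈ {w | L w < L (I.DA p m)} := hL.1 ▸ Or.inr rfl
      exact this
    refine hp ⟨m, w, L, hP, (I.DA_stable _ m w ?_).trans h2, by rw [h]⟩
    rwa [Function.update_self, h]
  · refine hp ⟨m, w, L, hP, ?_, by rw [h]; exact h1.le⟩
    rwa [(Equiv.symm_apply_eq _).2 h.symm]

end Market

/-! ### The five-by-five example -/

theorem daState_fiveProfile :
    daState fiveProfile fiveMarket.women (5 * 5) = ![0, 0, 1, 1, 1] := by
  have h1 : daRound fiveProfile fiveMarket.women (fun _ => 0) = ![0, 0, 0, 1, 0] := by decide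
  have h2 : daRound fiveProfile fiveMarket.women ![0, 0, 0, 1, 0] = ![0, 0, 0, 1, 1] := by decide
  have h3 : daRound fiveProfile fiveMarket.women ![0, 0, 0, 1, 1] = ![0, 0, 1, 1, 1] := by decide
  have h4 : daRound fiveProfile fiveMarket.women ![0, 0, 1, 1, 1] = ![0, 0, 1, 1, 1] := by decide
  have h5 : daState fiveProfile fiveMarket.women 3 = ![0, 0, 1, 1, 1] := by
    rw [daState_succ, daState_succ, daState_succ, ← h3, ← h2, ← h1]
    rfl
  have h6 : ∀ t, daState fiveProfile fiveMarket.women (t + 3) = ![0, 0, 1, 1, 1] := by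
    intro t
    induction t with
    | zero => exact h5
    | succ t ih => rw [Nat.add_right_comm, daState_succ, ih, h4]
  exact h6 22

theorem fiveMarket_DA_fiveProfile (m : Fin 5) :
    fiveMarket.DA fiveProfile m = (![1, 0, 2, 4, 3] : Fin 5 → Fin 5) m := by
  refine deferredAcceptance_eq_of_target _ _ _ _ _ _ ?_
  rw [daState_fiveProfile]
  revert m
  decide

theorem fiveMarket_isBlocking : fiveMarket.IsBlocking (fiveMarket.DA fiveProfile) 2 0 := by
  have h : (fiveMarket.DA fiveProfile).symm 0 = 1 :=
    (Equiv.symm_apply_eq _).2 (fiveMarket_DA_fiveProfile 1).symm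
  rw [Market.IsBlocking, fiveMarket_DA_fiveProfile, h]
  decide

/-- The accomplice `w_4` already has her first choice `m_5`, so she cannot gain. -/
theorem fiveMarket_isNash : fiveMarket.IsNash {(2, 3)} fiveProfile := by
  rintro ⟨m, w, L, hP, hw, -⟩
  obtain ⟨-, rfl⟩ := Prod.mk_inj.1 hP
  have h : (fiveMarket.DA fiveProfile).symm 3 = 4 :=
    (Equiv.symm_apply_eq _).2 (fiveMarket_DA_fiveProfile 4).symm
  have h0 : fiveMarket.women 3 4 = 0 := by decide
  rw [h, h0] at hw
  exact absurd hw (Fin.not_lt_zero _)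

theorem fiveMarket_isStrategyProfile : fiveMarket.IsStrategyProfile {(2, 3)} fiveProfile := by
  intro m hm
  refine Function.update_of_ne ?_ _ _
  rintro rfl
  exact hm 3 rfl

theorem mainTheorem2 {M W : Type*} [Fintype M] [Fintype W] [DecidableEq M] [DecidableEq W]
    {n : ℕ} (I : Market M W n) (P : Set (M × W)) :
    -- (i) push-up dynamics exist, converge, and their fixed points are stable equilibria
    ((∃ p, I.IsPushUpDynamic P p) ∧
      ∀ p, I.IsPushUpDynamic P p →
        (∃ t, p (t + 1) = p t) ∧
        ∀ t, p (t + 1) = p t →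
          I.IsStrategyProfile P (p t) ∧ I.IsNash P (p t) ∧ I.IsStable (I.DA (p t))) ∧
    -- (ii) in the explicit market, with the single strategic pair `(m_3, w_4)`, some equilibrium
    -- has an unstable outcome: `(m_3, w_1)` blocks it
    (fiveMarket.IsStrategyProfile {(2, 3)} fiveProfile ∧
      fiveMarket.IsNash {(2, 3)} fiveProfile ∧
      fiveMarket.IsBlocking (fiveMarket.DA fiveProfile) 2 0 ∧
      ¬ fiveMarket.IsStable (fiveMarket.DA fiveProfile)) ∧
    -- every equilibrium outcome is `((M × W) \ P)`-stable, hence stable if `P = M × W`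
    (∀ p, I.IsNash P p → I.IsXStable (Set.univ \ P) (I.DA p)) ∧
    (P = Set.univ → ∀ p, I.IsNash P p → I.IsStable (I.DA p)) := by

  refine ⟨⟨I.exists_isPushUpDynamic P, fun p hp => ⟨hp.exists_fixed, fun t ht =>
    ⟨hp.isStrategyProfile t, hp.isNash_of_fixed ht, (hp.truthfulBelow t).isStable⟩⟩⟩,
    ⟨fiveMarket_isStrategyProfile, fiveMarket_isNash, fiveMarket_isBlocking,
      fun h => h 2 0 fiveMarket_isBlocking⟩, fun p hp => hp.isXStable, ?_⟩
  rintro rfl p hp m w h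
  exact (hp.isXStable m w h).2 trivial
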